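/- Let $p$ be a prime and let $R$ be a nonzero $C_p$-Tambara functor, with restriction $\mathrm{Res}$, transfer $\mathrm{Tr}$, norm $\mathrm{Nm}$, and with the action of $C_p$ on $R(C_p/e)$. Write $\Phi = R(C_p/C_p)/\mathrm{Tr}$ for the quotient of $R(C_p/C_p)$ by the image of the transfer. The ghost of $R$ is the $C_p$-Tambara functor $\mathrm{ghost}(R)$ with $\mathrm{ghost}(R)(C_p/e)=R(C_p/e)$ and $\mathrm{ghost}(R)(C_p/C_p)=R(C_p/e)^{C_p}\times\Phi$, with restriction $(a,b)\mapsto a$, transfer $x\mapsto(\sum_{g} gx,0)$ and norm $x\mapsto(\prod_g gx,[\mathrm{Nm}\,x])$. For ideals $\mathfrak p\subseteq R(C_p/e)$ and $\mathfrak q\subseteq\Phi$, a Tambara ideal of $\mathrm{ghost}(R)$ is called $(\mathfrak p;\mathfrak q)$ if it equals $\mathfrak p$ in level $C_p/e$ and $\mathfrak p^{C_p}\times\mathfrak q$ in level $C_p/C_p$, where $\mathfrak p^{C_p}=\mathfrak p\cap R(C_p/e)^{C_p}$. An ideal $\mathfrak p$ of $R(C_p/e)$ is $C_p$-prime if it is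 proper, $C_p$-invariant, and $x\cdot gy\in\mathfrak p$ for all $g\in C_p$ implies $x\in\mathfrak p$ or $y\in\mathfrak p$. The Nakaoka spectrum $\mathrm{Spec}(T)$ of a $C_p$-Tambara functor $T$ is the set of its prime Tambara ideals (the proper Tambara ideals $P$ such that $I\cdot J\subseteq P$ implies $I\subseteq P$ or $J\subseteq P$, where $I\cdot J$ is the Tambara ideal generated by the levelwise products), with the topology whose closed sets are generated by the sets $V(I)=\{P : I\subseteq P\}$ for Tambara ideals $I$. Its $e$-th stratum is the image of the map $\mathrm{Spec}(T(C_p/e))\to\mathrm{Spec}(\mathrm{CoInd}_e^{C_p}T(C_p/e))\to\mathrm{Spec}(T)$ that sends a prime ideal $\mathfrak r$ of the ring $T(C_p/e)$ to the contraction of $\mathrm{CoInd}_e^{C_p}\mathfrak r$ along the adjunction unit $T\to\mathrm{CoInd}_e^{C_p}\mathrm{Res}_e^{C_p}T$. Then: 1. A prime ideal of $\mathrm{ghost}(R)$ of the form $(\mathfrak p;\mathfrak q)$ lies in the $e$-th stratum of $\mathrm{Spec}(\mathrm{ghost}(R))$ if and only if $\mathfrak q=\Phi$. A prime ideal of $\mathrm{ghost}(R)$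 lies in the $e$-th stratum if and only if it is equal to $(\mathfrak p;\Phi)$ for some $C_p$-prime ideal $\mathfrak p$ of $R(C_p/e)$, and for every $C_p$-prime ideal $\mathfrak p$ of $R(C_p/e)$ there is a prime ideal $(\mathfrak p;\Phi)$ of $\mathrm{ghost}(R)$. 2. If $\mathrm{Tr}:R(C_p/e)\to R(C_p/C_p)$ is not surjective, then the $e$-th stratum of $\mathrm{Spec}(\mathrm{ghost}(R))$ is not open. 3. If the ring $R(C_p/e)^{C_p}$ has finitely many minimal prime ideals, then the $e$-th stratum of $\mathrm{Spec}(\mathrm{ghost}(R))$ is closed. -/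

import Mathlib

universe u

/-- The cyclic group of order `p`, written multiplicatively. -/
abbrev Cp (p : ℕ) : Type := Multiplicative (ZMod p)

section Combinatorics

open scoped Pointwise

/-- The monomial `∏_{g ∈ S} g a * ∏_{g ∉ S} g b` in a commutative ring with `C_p`-action. -/
def crossMonomial {p : ℕ} [Fact p.Prime] {B : Type u} [CommRing B] [MulSemiringAction (Cp p) B]
    (a b : B) (S : Finset (Cp p)) : B :=
  (∏ g ∈ S, g • a) * ∏ g ∈ Finset.univ \ S, g • b

/-- A chosen representative of the orbit of `S` under the translation action of `C_p` on its
subsets. -/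
noncomputable def orbitRep {p : ℕ} [Fact p.Prime] (S : Finset (Cp p)) : Finset (Cp p) :=
  (Quotient.mk (MulAction.orbitRel (Cp p) (Finset (Cp p))) S).out

/-- A system of representatives, one for each translation orbit, of the subsets of `C_p` other than
the empty set and the whole group. -/
noncomputable def crossReps (p : ℕ) [Fact p.Prime] : Finset (Finset (Cp p)) :=
  (Finset.univ.filter fun S : Finset (Cp p) => S ≠ ∅ ∧ S ≠ Finset.univ).image orbitRep

theorem exists_smul_orbitRep {p : ℕ} [Fact p.Prime] (S : Finset (Cp p)) :
    ∃ g : Cp p, g • orbitRep S = S := by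
  have h : (MulAction.orbitRel (Cp p) (Finset (Cp p))).r (orbitRep S) S :=
    Quotient.exact (Quotient.out_eq (Quotient.mk (MulAction.orbitRel (Cp p) (Finset (Cp p))) S))
  obtain ⟨g, hg⟩ := MulAction.orbitRel_apply.1 h
  exact ⟨g⁻¹, by rw [← hg]; simp⟩

theorem orbitRep_smul {p : ℕ} [Fact p.Prime] (g : Cp p) (S : Finset (Cp p)) :
    orbitRep (g • S) = orbitRep S := by
  unfold orbitRep
  congr 1
  exact Quotient.sound ⟨g, rfl⟩

theorem smul_crossMonomial {p : ℕ} [Fact p.Prime] {B : Type u} [CommRing B]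
    [MulSemiringAction (Cp p) B] (a b : B) (h : Cp p) (S : Finset (Cp p)) :
    h • crossMonomial a b S = crossMonomial a b (h • S) := by
  have key : ∀ (c : B) (T : Finset (Cp p)), h • ∏ g ∈ T, g • c = ∏ g ∈ h • T, g • c := by
    intro c T
    rw [Finset.smul_prod']
    refine Finset.prod_nbij (fun g => h * g) ?_ ?_ ?_ ?_
    · intro g hg
      exact Finset.smul_mem_smul_finset hg
    · intro x _ y _ hxy
      exact mul_left_cancel hxy
    · intro x hx
      obtain ⟨y, hy, rfl⟩ := Finset.mem_smul_finset.1 (Finset.mem_coe.1 hx)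
      exact ⟨y, hy, rfl⟩
    · intro g _
      rw [smul_smul]
  unfold crossMonomial
  rw [smul_mul', key, key, Finset.smul_finset_sdiff, Finset.smul_finset_univ]

/-- Translation acts freely on the subsets of `C_p` other than `∅` and the whole group. -/
theorem eq_one_of_smul_eq {p : ℕ} [Fact p.Prime] {S : Finset (Cp p)} (h0 : S ≠ ∅)
    (h1 : S ≠ Finset.univ) {g : Cp p} (hg : g • S = S) : g = 1 := by
  by_contra hne
  apply h1
  have hcard : Nat.card (Cp p) = p := by simp
  have hstab : ∀ h : Cp p, h • S = S := by
    intro h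
    have hz : h ∈ Subgroup.zpowers g := mem_zpowers_of_prime_card hcard hne
    have : Subgroup.zpowers g ≤ MulAction.stabilizer (Cp p) S := by
      rw [Subgroup.zpowers_le]; exact hg
    exact this hz
  obtain ⟨x, hx⟩ := Finset.nonempty_iff_ne_empty.2 h0
  refine Finset.eq_univ_iff_forall.2 fun y => ?_
  have := Finset.smul_mem_smul_finset (a := y * x⁻¹) hx
  rw [hstab] at this
  simpa using this

theorem smul_proper {p : ℕ} [Fact p.Prime] (g : Cp p) {S : Finset (Cp p)}
    (h : S ≠ ∅ ∧ S ≠ Finset.univ) : g • S ≠ ∅ ∧ g • S ≠ Finset.univ := by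
  refine ⟨fun h' => h.1 ?_, fun h' => h.2 ?_⟩
  · simpa using h'
  · have := congrArg (fun T => g⁻¹ • T) h'
    simpa [Finset.smul_finset_univ] using this

theorem crossReps_spec {p : ℕ} [Fact p.Prime] {S : Finset (Cp p)} (hS : S ∈ crossReps p) :
    (S ≠ ∅ ∧ S ≠ Finset.univ) ∧ orbitRep S = S := by
  obtain ⟨T, hT, rfl⟩ := Finset.mem_image.1 hS
  obtain ⟨g, hg⟩ := exists_smul_orbitRep T
  have hT' := (Finset.mem_filter.1 hT).2
  have e : orbitRep T = g⁻¹ • T := eq_inv_smul_iff.2 hg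
  refine ⟨?_, ?_⟩
  · rw [e]; exact smul_proper _ hT'
  · rw [e, orbitRep_smul, e]

/-- The product over `C_p` of the conjugates of a sum. -/
theorem prod_smul_add {p : ℕ} [Fact p.Prime] {B : Type u} [CommRing B]
    [MulSemiringAction (Cp p) B] (a b : B) :
    ∏ g : Cp p, g • (a + b) = ∏ g : Cp p, g • a + ∏ g : Cp p, g • b +
      ∑ S ∈ crossReps p, ∑ g : Cp p, g • crossMonomial a b S := by
  have h1 : ∏ g : Cp p, g • (a + b) = ∑ S : Finset (Cp p), crossMonomial a b S := by
    simp only [smul_add]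
    rw [Finset.prod_add, Finset.powerset_univ]
    rfl
  have h2 : ∑ S ∈ crossReps p, ∑ g : Cp p, g • crossMonomial a b S =
      ∑ S ∈ Finset.univ.filter (fun S : Finset (Cp p) => S ≠ ∅ ∧ S ≠ Finset.univ),
        crossMonomial a b S := by
    rw [← Finset.sum_product']
    refine Finset.sum_nbij (fun x => x.2 • x.1) ?_ ?_ ?_ ?_
    · rintro ⟨S, g⟩ hx
      have hS := (crossReps_spec (Finset.mem_product.1 hx).1).1
      exact Finset.mem_filter.2 ⟨Finset.mem_univ _, smul_proper g hS⟩
    · rintro ⟨S, g⟩ hx ⟨T, h⟩ hy hxy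
      have hS := crossReps_spec (Finset.mem_product.1 hx).1
      have hT := crossReps_spec (Finset.mem_product.1 hy).1
      simp only at hxy hS hT
      have e : S = T := by
        rw [← hS.2, ← hT.2, ← orbitRep_smul g S, hxy, orbitRep_smul]
      subst e
      have : (h⁻¹ * g) • S = S := by rw [mul_smul, hxy]; simp
      have := eq_one_of_smul_eq hS.1.1 hS.1.2 this
      rw [inv_mul_eq_one] at this
      rw [this]
    · intro S hS
      obtain ⟨g, hg⟩ := exists_smul_orbitRep S
      refine ⟨(orbitRep S, g), ?_, hg⟩
      simp only [Finset.coe_product, Set.mem_prod, Finset.mem_coe, Finset.mem_univ, and_true]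
      exact Finset.mem_image_of_mem _ hS
    · rintro ⟨S, g⟩ _
      exact smul_crossMonomial a b g S
  have hne : (∅ : Finset (Cp p)) ≠ Finset.univ := Finset.univ_nonempty.ne_empty.symm
  have h3 : (Finset.univ.filter fun S : Finset (Cp p) => ¬ (S ≠ ∅ ∧ S ≠ Finset.univ)) =
      {Finset.univ, ∅} := by
    ext S
    simp only [Finset.mem_filter, Finset.mem_univ, true_and, Finset.mem_insert,
      Finset.mem_singleton]
    tauto
  rw [h1, h2, ← Finset.sum_filter_not_add_sum_filter Finset.univ
    (fun S : Finset (Cp p) => S ≠ ∅ ∧ S ≠ Finset.univ), h3, Finset.sum_pair hne.symm]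
  simp [crossMonomial]

end Combinatorics

/-- A `C_p`-Tambara functor, presented by its Lewis diagram: commutative rings `lvlG = R(C_p/C_p)`
and `lvlE = R(C_p/e)`, the latter with an action of the Weyl group `C_p`, together with
restriction, transfer and norm. -/
structure CpTambara (p : ℕ) [Fact p.Prime] where
  lvlG : Type u
  lvlE : Type u
  [ringG : CommRing lvlG]
  [ringE : CommRing lvlE]
  [act : MulSemiringAction (Cp p) lvlE]
  res : lvlG →+* lvlE
  tr : lvlE →+ lvlG
  nm : lvlE →* lvlG
  smul_res : ∀ (g : Cp p) (x : lvlG), g • res x = res x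
  tr_smul : ∀ (g : Cp p) (x : lvlE), tr (g • x) = tr x
  nm_smul : ∀ (g : Cp p) (x : lvlE), nm (g • x) = nm x
  res_tr : ∀ x : lvlE, res (tr x) = ∑ g : Cp p, g • x
  res_nm : ∀ x : lvlE, res (nm x) = ∏ g : Cp p, g • x
  /-- Frobenius reciprocity -/
  tr_mul_res : ∀ (x : lvlE) (y : lvlG), tr (x * res y) = tr x * y
  nm_zero : nm 0 = 0
  /-- Tambara reciprocity: the norm of a sum -/
  nm_add : ∀ a b : lvlE,
    nm (a + b) = nm a + nm b + ∑ S ∈ crossReps p, tr (crossMonomial a b S)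

namespace CpTambara

attribute [instance] ringG ringE act

/-- `R` is not the zero Tambara functor. -/
def IsNonzero {p : ℕ} [Fact p.Prime] (R : CpTambara.{u} p) : Prop :=
  Nontrivial R.lvlG ∨ Nontrivial R.lvlE

/-- Morphisms of `C_p`-Tambara functors. -/
structure Hom {p : ℕ} [Fact p.Prime] (R S : CpTambara.{u} p) where
  mapG : R.lvlG →+* S.lvlG
  mapE : R.lvlE →+* S.lvlE
  map_smul : ∀ (g : Cp p) (x : R.lvlE), mapE (g • x) = g • mapE x
  map_res : ∀ x : R.lvlG, mapE (R.res x) = S.res (mapG x)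
  map_tr : ∀ x : R.lvlE, mapG (R.tr x) = S.tr (mapE x)
  map_nm : ∀ x : R.lvlE, mapG (R.nm x) = S.nm (mapE x)

/-- Tambara ideals. -/
@[ext]
structure TIdeal {p : ℕ} [Fact p.Prime] (R : CpTambara.{u} p) where
  idealG : Ideal R.lvlG
  idealE : Ideal R.lvlE
  tr_mem : ∀ x ∈ idealE, R.tr x ∈ idealG
  nm_mem : ∀ x ∈ idealE, R.nm x ∈ idealG
  res_mem : ∀ x ∈ idealG, R.res x ∈ idealE
  smul_mem : ∀ (g : Cp p), ∀ x ∈ idealE, g • x ∈ idealE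

namespace TIdeal

instance {p : ℕ} [Fact p.Prime] (R : CpTambara.{u} p) : PartialOrder (TIdeal R) where
  le I J := I.idealG ≤ J.idealG ∧ I.idealE ≤ J.idealE
  le_refl I := ⟨le_refl _, le_refl _⟩
  le_trans I J K h h' := ⟨h.1.trans h'.1, h.2.trans h'.2⟩
  le_antisymm I J h h' := TIdeal.ext (le_antisymm h.1 h'.1) (le_antisymm h.2 h'.2)

/-- The unit ideal. -/
instance {p : ℕ} [Fact p.Prime] (R : CpTambara.{u} p) : Top (TIdeal R) where
  top := ⟨⊤, ⊤, by simp, by simp, by simp, by simp⟩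

/-- The smallest Tambara ideal containing given subsets of the two levels. -/
def span {p : ℕ} [Fact p.Prime] (R : CpTambara.{u} p) (A : Set R.lvlG) (B : Set R.lvlE) :
    TIdeal R where
  idealG := ⨅ K : {K : TIdeal R // A ⊆ K.idealG ∧ B ⊆ K.idealE}, K.1.idealG
  idealE := ⨅ K : {K : TIdeal R // A ⊆ K.idealG ∧ B ⊆ K.idealE}, K.1.idealE
  tr_mem x hx := by
    simp only [Submodule.mem_iInf] at hx ⊢
    exact fun K => K.1.tr_mem x (hx K)
  nm_mem x hx := by
    simp only [Submodule.mem_iInf] at hx ⊢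
    exact fun K => K.1.nm_mem x (hx K)
  res_mem x hx := by
    simp only [Submodule.mem_iInf] at hx ⊢
    exact fun K => K.1.res_mem x (hx K)
  smul_mem g x hx := by
    simp only [Submodule.mem_iInf] at hx ⊢
    exact fun K => K.1.smul_mem g x (hx K)

/-- The product of Tambara ideals: the Tambara ideal generated by the levelwise products. -/
instance {p : ℕ} [Fact p.Prime] (R : CpTambara.{u} p) : Mul (TIdeal R) where
  mul I J := span R (I.idealG * J.idealG : Ideal R.lvlG) (I.idealE * J.idealE : Ideal R.lvlE)

/-- Prime Tambara ideals. -/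
def IsPrime {p : ℕ} [Fact p.Prime] {R : CpTambara.{u} p} (P : TIdeal R) : Prop :=
  P ≠ ⊤ ∧ ∀ I J : TIdeal R, I * J ≤ P → I ≤ P ∨ J ≤ P

theorem mul_le_iff {p : ℕ} [Fact p.Prime] {R : CpTambara.{u} p} {I J P : TIdeal R} :
    I * J ≤ P ↔ I.idealG * J.idealG ≤ P.idealG ∧ I.idealE * J.idealE ≤ P.idealE := by
  constructor
  · intro h
    refine ⟨le_trans ?_ h.1, le_trans ?_ h.2⟩
    · exact le_iInf fun K => K.2.1
    · exact le_iInf fun K => K.2.2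
  · intro h
    exact ⟨iInf_le_of_le ⟨P, h.1, h.2⟩ le_rfl, iInf_le_of_le ⟨P, h.1, h.2⟩ le_rfl⟩

/-- The contraction of a Tambara ideal along a morphism. -/
def comap {p : ℕ} [Fact p.Prime] {R S : CpTambara.{u} p} (f : Hom R S) (J : TIdeal S) :
    TIdeal R where
  idealG := J.idealG.comap f.mapG
  idealE := J.idealE.comap f.mapE
  tr_mem x hx := by
    rw [Ideal.mem_comap] at hx ⊢
    rw [f.map_tr]; exact J.tr_mem _ hx
  nm_mem x hx := by
    rw [Ideal.mem_comap] at hx ⊢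
    rw [f.map_nm]; exact J.nm_mem _ hx
  res_mem x hx := by
    rw [Ideal.mem_comap] at hx ⊢
    rw [f.map_res]; exact J.res_mem _ hx
  smul_mem g x hx := by
    rw [Ideal.mem_comap] at hx ⊢
    rw [f.map_smul]; exact J.smul_mem g _ hx

/-- An ideal of the underlying ring that is stable under `C_p` contains every mixed term with one
entry in it. -/
theorem crossMonomial_mem {p : ℕ} [Fact p.Prime] {R : CpTambara.{u} p} (I : Ideal R.lvlE)
    (hI : ∀ (g : Cp p), ∀ x ∈ I, g • x ∈ I) {a : R.lvlE} (ha : a ∈ I) (b : R.lvlE)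
    {S : Finset (Cp p)} (hS : S ∈ crossReps p) : crossMonomial a b S ∈ I := by
  obtain ⟨g, hg⟩ := Finset.nonempty_iff_ne_empty.2 (crossReps_spec hS).1.1
  refine I.mul_mem_right _ ?_
  rw [← Finset.mul_prod_erase _ _ hg]
  exact I.mul_mem_right _ (hI g a ha)

/-- The extension of a Tambara ideal along a morphism. -/
def map {p : ℕ} [Fact p.Prime] {R S : CpTambara.{u} p} (f : Hom R S) (I : TIdeal R) :
    TIdeal S :=
  have hsmul : ∀ (g : Cp p), ∀ x ∈ I.idealE.map f.mapE, g • x ∈ I.idealE.map f.mapE := by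
    intro g x hx
    have hle : I.idealE.map f.mapE ≤
        (I.idealE.map f.mapE).comap (MulSemiringAction.toRingHom (Cp p) S.lvlE g) := by
      rw [Ideal.map_le_iff_le_comap]
      intro y hy
      rw [Ideal.mem_comap, Ideal.mem_comap, MulSemiringAction.toRingHom_apply, ← f.map_smul]
      exact Ideal.mem_map_of_mem _ (I.smul_mem g y hy)
    exact hle hx
  have htr : ∀ x ∈ I.idealE.map f.mapE, S.tr x ∈ I.idealG.map f.mapG ⊔
      Ideal.span (S.tr '' (I.idealE.map f.mapE)) := fun x hx =>
    Ideal.mem_sup_right (Ideal.subset_span ⟨x, hx, rfl⟩)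
  { idealG := I.idealG.map f.mapG ⊔ Ideal.span (S.tr '' (I.idealE.map f.mapE))
    idealE := I.idealE.map f.mapE
    tr_mem := htr
    nm_mem := by
      intro x hx
      have hx' := hx
      rw [Ideal.map] at hx'
      induction hx' using Submodule.span_induction with
      | mem y hy =>
        obtain ⟨z, hz, rfl⟩ := hy
        rw [← f.map_nm]
        exact Ideal.mem_sup_left (Ideal.mem_map_of_mem _ (I.nm_mem z hz))
      | zero => rw [S.nm_zero]; exact Ideal.zero_mem _
      | add y z hy hz ihy ihz =>
        rw [S.nm_add]
        refine Ideal.add_mem _ (Ideal.add_mem _ (ihy hy) (ihz hz)) (Ideal.sum_mem _ ?_)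
        intro T hT
        exact htr _ (crossMonomial_mem _ hsmul hy z hT)
      | smul a y hy ih =>
        rw [smul_eq_mul, map_mul]
        exact Ideal.mul_mem_left _ _ (ih hy)
    res_mem := by
      intro x hx
      have hle : I.idealG.map f.mapG ⊔ Ideal.span (S.tr '' (I.idealE.map f.mapE)) ≤
          (I.idealE.map f.mapE).comap S.res := by
        refine sup_le ?_ ?_
        · rw [Ideal.map_le_iff_le_comap]
          intro y hy
          rw [Ideal.mem_comap, Ideal.mem_comap, ← f.map_res]
          exact Ideal.mem_map_of_mem _ (I.res_mem y hy)
        · rw [Ideal.span_le]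
          rintro _ ⟨y, hy, rfl⟩
          rw [SetLike.mem_coe, Ideal.mem_comap, S.res_tr]
          exact Ideal.sum_mem _ fun g _ => hsmul g y hy
      exact hle hx
    smul_mem := hsmul }

theorem IsPrime.comap {p : ℕ} [Fact p.Prime] {R S : CpTambara.{u} p} (f : Hom R S)
    {P : TIdeal S} (hP : P.IsPrime) : (P.comap f).IsPrime := by
  refine ⟨fun h => hP.1 ?_, fun I J hIJ => ?_⟩
  · have hG : (1 : R.lvlG) ∈ (P.comap f).idealG := by rw [h]; exact Submodule.mem_top
    have hE : (1 : R.lvlE) ∈ (P.comap f).idealE := by rw [h]; exact Submodule.mem_top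
    have hG' : f.mapG 1 ∈ P.idealG := hG
    have hE' : f.mapE 1 ∈ P.idealE := hE
    rw [map_one] at hG' hE'
    exact TIdeal.ext ((Ideal.eq_top_iff_one _).2 hG') ((Ideal.eq_top_iff_one _).2 hE')
  · rw [mul_le_iff] at hIJ
    have hle : ∀ K : TIdeal R, K.map f ≤ P → K ≤ P.comap f := by
      intro K hK
      refine ⟨?_, ?_⟩
      · exact Ideal.map_le_iff_le_comap.1 (le_trans le_sup_left hK.1)
      · exact Ideal.map_le_iff_le_comap.1 hK.2
    refine (hP.2 (I.map f) (J.map f) ?_).imp (hle I) (hle J)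
    rw [mul_le_iff]
    have hE : (I.map f).idealE * (J.map f).idealE ≤ P.idealE := by
      change I.idealE.map f.mapE * J.idealE.map f.mapE ≤ P.idealE
      rw [← Ideal.map_mul, Ideal.map_le_iff_le_comap]
      exact hIJ.2
    refine ⟨?_, hE⟩
    have hG : I.idealG.map f.mapG * J.idealG.map f.mapG ≤ P.idealG := by
      rw [← Ideal.map_mul, Ideal.map_le_iff_le_comap]
      exact hIJ.1
    have hl : ∀ x ∈ (I.map f).idealE, ∀ y ∈ (J.map f).idealG, S.tr x * y ∈ P.idealG := by
      intro x hx y hy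
      rw [← S.tr_mul_res]
      exact P.tr_mem _ (hE (Ideal.mul_mem_mul hx ((J.map f).res_mem y hy)))
    have hr : ∀ x ∈ (I.map f).idealG, ∀ y ∈ (J.map f).idealE, x * S.tr y ∈ P.idealG := by
      intro x hx y hy
      rw [mul_comm, ← S.tr_mul_res, mul_comm]
      exact P.tr_mem _ (hE (Ideal.mul_mem_mul ((I.map f).res_mem x hx) hy))
    change (I.idealG.map f.mapG ⊔ Ideal.span (S.tr '' (I.idealE.map f.mapE))) *
      (J.map f).idealG ≤ P.idealG
    rw [Ideal.sup_mul]
    refine sup_le ?_ ?_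
    · change I.idealG.map f.mapG *
        (J.idealG.map f.mapG ⊔ Ideal.span (S.tr '' (J.idealE.map f.mapE))) ≤ P.idealG
      rw [Ideal.mul_sup]
      refine sup_le hG ?_
      rw [Ideal.mul_le]
      intro x hx y hy
      have : Ideal.span (S.tr '' (J.idealE.map f.mapE)) ≤
          Submodule.comap (LinearMap.mulLeft S.lvlG x) P.idealG := by
        rw [Submodule.span_le]
        rintro _ ⟨z, hz, rfl⟩
        exact hr x (Ideal.mem_sup_left hx) z hz
      exact this hy
    · rw [Ideal.mul_le]
      intro x hx y hy
      have : Ideal.span (S.tr '' (I.idealE.map f.mapE)) ≤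
          Submodule.comap (LinearMap.mulRight S.lvlG y) P.idealG := by
        rw [Submodule.span_le]
        rintro _ ⟨z, hz, rfl⟩
        exact hl z hz y hy
      exact this hx

end TIdeal

/-- The Nakaoka spectrum: the set of prime Tambara ideals. -/
structure Spec {p : ℕ} [Fact p.Prime] (R : CpTambara.{u} p) where
  ideal : TIdeal R
  isPrime : ideal.IsPrime

/-- The basic closed subset `V(I)`. -/
def zeroLocus {p : ℕ} [Fact p.Prime] {R : CpTambara.{u} p} (I : TIdeal R) : Set (Spec R) :=
  {P | I ≤ P.ideal}

/-- The topology on the Nakaoka spectrum whose closed sets are generated by the `V(I)`. -/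
instance {p : ℕ} [Fact p.Prime] (R : CpTambara.{u} p) : TopologicalSpace (Spec R) :=
  TopologicalSpace.generateFrom {U | ∃ I : TIdeal R, U = (zeroLocus I)ᶜ}

/-- The map on Nakaoka spectra induced by a morphism. -/
def Spec.comap {p : ℕ} [Fact p.Prime] {R S : CpTambara.{u} p} (f : Hom R S) (P : Spec S) :
    Spec R :=
  ⟨P.ideal.comap f, P.isPrime.comap f⟩

/-- The action of `C_p` on functions `C_p → S` by translation of the argument. -/
abbrev coindAction (p : ℕ) (S : Type u) [CommRing S] :
    MulSemiringAction (Cp p) (Cp p → S) where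
  smul h f := fun g => f (g * h)
  one_smul f := funext fun g => congrArg f (mul_one g)
  mul_smul h k f := funext fun g => congrArg f (mul_assoc g h k).symm
  smul_zero _ := rfl
  smul_add _ _ _ := rfl
  smul_one _ := rfl
  smul_mul _ _ _ := rfl

/-- The coinduction of a commutative ring `S` (that is, of a Tambara functor for the trivial group)
to `C_p`: it is `S` in level `C_p/C_p` and `Map(C_p, S)` in level `C_p/e`. -/
def coind (p : ℕ) [Fact p.Prime] (S : Type u) [CommRing S] : CpTambara.{u} p :=
  letI : MulSemiringAction (Cp p) (Cp p → S) := coindAction p S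
  have smul_def : ∀ (h : Cp p) (f : Cp p → S) (g : Cp p), (h • f) g = f (g * h) :=
    fun _ _ _ => rfl
  { lvlG := S
    lvlE := Cp p → S
    res := Pi.constRingHom (Cp p) S
    tr := { toFun := fun f => ∑ g, f g
            map_zero' := by simp
            map_add' := fun f h => by simp [Finset.sum_add_distrib] }
    nm := { toFun := fun f => ∏ g, f g
            map_one' := by simp
            map_mul' := fun f h => by simp [Finset.prod_mul_distrib] }
    smul_res := fun _ _ => rfl
    tr_smul := fun h f => Fintype.sum_equiv (Equiv.mulRight h) _ _ fun _ => rfl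
    nm_smul := fun h f => Fintype.prod_equiv (Equiv.mulRight h) _ _ fun _ => rfl
    res_tr := fun f => by
      funext k
      rw [Finset.sum_apply]
      exact Fintype.sum_equiv (Equiv.mulLeft k⁻¹) _ _ fun g => by simp [smul_def]
    res_nm := fun f => by
      funext k
      rw [Finset.prod_apply]
      exact Fintype.prod_equiv (Equiv.mulLeft k⁻¹) _ _ fun g => by simp [smul_def]
    tr_mul_res := fun f y => by
      change ∑ g, f g * y = (∑ g, f g) * y
      rw [Finset.sum_mul]
    nm_zero := Finset.prod_eq_zero (Finset.mem_univ 1) rfl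
    nm_add := fun a b => by
      have h := congrFun (prod_smul_add (p := p) a b) 1
      simp only [Finset.prod_apply, Finset.sum_apply, Pi.add_apply, smul_def, one_mul] at h
      exact h }

/-- The coinduction of an ideal of `S`. -/
def coindIdeal (p : ℕ) [Fact p.Prime] {S : Type u} [CommRing S] (q : Ideal S) :
    TIdeal (coind p S) where
  idealG := q
  idealE := Ideal.pi fun _ : Cp p => q
  tr_mem _ hx := Ideal.sum_mem q fun g _ => hx g
  nm_mem _ hx := Ideal.prod_mem q (i := (1 : Cp p)) (Finset.mem_univ _) (hx 1)
  res_mem _ hx := fun _ => hx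
  smul_mem g _ hx := fun k => hx (k * g)

theorem coindIdeal_isPrime (p : ℕ) [Fact p.Prime] {S : Type u} [CommRing S] (q : Ideal S)
    [hq : q.IsPrime] : (coindIdeal p q).IsPrime := by
  refine ⟨fun h => hq.ne_top (congrArg TIdeal.idealG h), fun I J hIJ => ?_⟩
  rw [TIdeal.mul_le_iff] at hIJ
  have key : ∀ K : TIdeal (coind p S), ¬ K ≤ coindIdeal p q →
      ∃ f : Cp p → S, f ∈ K.idealE ∧ f 1 ∉ q := by
    intro K hK
    by_contra hcon
    push Not at hcon
    refine hK ⟨fun x hx => hcon _ (K.res_mem x hx), fun f hf g => ?_⟩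
    have := hcon _ (K.smul_mem g f hf)
    change f (1 * g) ∈ q at this
    rwa [one_mul] at this
  by_contra hcon
  push Not at hcon
  obtain ⟨f, hf, hf1⟩ := key I hcon.1
  obtain ⟨h, hh, hh1⟩ := key J hcon.2
  exact (hq.mem_or_mem (hIJ.2 (Ideal.mul_mem_mul hf hh) 1)).elim hf1 hh1

/-- The unit `R → CoInd_e Res_e R` of the adjunction between restriction to the trivial group and
coinduction. -/
def coindUnit {p : ℕ} [Fact p.Prime] (R : CpTambara.{u} p) : Hom R (coind p R.lvlE) where
  mapG := R.res
  mapE := RingHom.pi fun g => MulSemiringAction.toRingHom (Cp p) R.lvlE g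
  map_smul h x := funext fun g => smul_smul g h x
  map_res x := funext fun g => R.smul_res g x
  map_tr x := R.res_tr x
  map_nm x := R.res_nm x

/-- The map `Spec(Res_e R) → Spec(CoInd_e Res_e R) → Spec(R)`, where the restriction of `R` to the
trivial group is the commutative ring `R(C_p/e)`. -/
def specRes {p : ℕ} [Fact p.Prime] (R : CpTambara.{u} p) (q : PrimeSpectrum R.lvlE) : Spec R :=
  Spec.comap R.coindUnit
    ⟨coindIdeal p q.asIdeal, haveI := q.isPrime; coindIdeal_isPrime p q.asIdeal⟩

/-- The stratum of `Spec(R)` indexed by the trivial subgroup. -/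
def eStratum {p : ℕ} [Fact p.Prime] (R : CpTambara.{u} p) : Set (Spec R) :=
  Set.range R.specRes

/-- The fixed-point ring `R(C_p/e)^{C_p}`. -/
abbrev fixedE {p : ℕ} [Fact p.Prime] (R : CpTambara.{u} p) : Subring R.lvlE :=
  FixedPoints.subring R.lvlE (Cp p)

/-- The image of the transfer, an ideal of `R(C_p/C_p)`. -/
def trIdeal {p : ℕ} [Fact p.Prime] (R : CpTambara.{u} p) : Ideal R.lvlG where
  carrier := Set.range R.tr
  add_mem' := by
    rintro _ _ ⟨x, rfl⟩ ⟨y, rfl⟩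
    exact ⟨x + y, map_add _ _ _⟩
  zero_mem' := ⟨0, map_zero _⟩
  smul_mem' := by
    rintro c _ ⟨x, rfl⟩
    exact ⟨x * R.res c, by rw [R.tr_mul_res, smul_eq_mul, mul_comm]⟩

/-- The ring `R(C_p/C_p)/Tr`. -/
abbrev geomFixed {p : ℕ} [Fact p.Prime] (R : CpTambara.{u} p) : Type u :=
  R.lvlG ⧸ R.trIdeal

/-- The ghost of `R`: it is `R(C_p/e)` in level `C_p/e` and `R(C_p/e)^{C_p} × R(C_p/C_p)/Tr` in
level `C_p/C_p`, with restriction the first projection, transfer `x ↦ (∑ g x, 0)` and norm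
`x ↦ (∏ g x, [Nm x])`. -/
def ghost {p : ℕ} [Fact p.Prime] (R : CpTambara.{u} p) : CpTambara.{u} p where
  lvlG := R.fixedE × R.geomFixed
  lvlE := R.lvlE
  res := R.fixedE.subtype.comp (RingHom.fst _ _)
  tr :=
    { toFun := fun x => (⟨∑ g : Cp p, g • x, fun h => by rw [← R.res_tr, R.smul_res]⟩, 0)
      map_zero' := by ext <;> simp
      map_add' := fun x y => by ext <;> simp [Finset.sum_add_distrib] }
  nm :=
    { toFun := fun x => (⟨∏ g : Cp p, g • x, fun h => by rw [← R.res_nm, R.smul_res]⟩,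
        Ideal.Quotient.mk _ (R.nm x))
      map_one' := by ext <;> simp
      map_mul' := fun x y => by ext <;> simp [Finset.prod_mul_distrib] }
  smul_res g x := x.1.2 g
  tr_smul h x := by
    refine Prod.ext (Subtype.ext ?_) rfl
    change ∑ g : Cp p, g • h • x = ∑ g : Cp p, g • x
    rw [← R.res_tr, ← R.res_tr, R.tr_smul]
  nm_smul h x := by
    refine Prod.ext (Subtype.ext ?_) ?_
    · change ∏ g : Cp p, g • h • x = ∏ g : Cp p, g • x
      rw [← R.res_nm, ← R.res_nm, R.nm_smul]
    · change Ideal.Quotient.mk _ (R.nm (h • x)) = Ideal.Quotient.mk _ (R.nm x)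
      rw [R.nm_smul]
  res_tr _ := rfl
  res_nm _ := rfl
  tr_mul_res x y := by
    refine Prod.ext (Subtype.ext ?_) (zero_mul _).symm
    change ∑ g : Cp p, g • (x * (y.1 : R.lvlE)) = (∑ g : Cp p, g • x) * (y.1 : R.lvlE)
    rw [Finset.sum_mul]
    refine Finset.sum_congr rfl fun g _ => ?_
    rw [smul_mul', y.1.2 g]
  nm_zero := by
    refine Prod.ext (Subtype.ext ?_) ?_
    · change ∏ g : Cp p, g • (0 : R.lvlE) = 0
      rw [← R.res_nm, R.nm_zero, map_zero]
    · change Ideal.Quotient.mk _ (R.nm 0) = 0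
      rw [R.nm_zero, map_zero]
  nm_add a b := by
    refine Prod.ext (Subtype.ext ?_) ?_
    · simp only [Prod.fst_add, Prod.fst_sum, Subring.coe_add, AddSubmonoidClass.coe_finsetSum]
      exact prod_smul_add a b
    · simp only [Prod.snd_add, Prod.snd_sum]
      change Ideal.Quotient.mk R.trIdeal (R.nm (a + b)) = Ideal.Quotient.mk R.trIdeal (R.nm a) +
        Ideal.Quotient.mk R.trIdeal (R.nm b) + ∑ S ∈ crossReps p, 0
      rw [R.nm_add, Finset.sum_const_zero, add_zero, ← RingHom.map_add, Ideal.Quotient.eq,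
        add_sub_cancel_left]
      exact Ideal.sum_mem _ fun S _ => ⟨_, rfl⟩

/-- The Tambara ideal `I` of the ghost of `R` is the ideal `(𝔭; 𝔮)`, which is `𝔭` in level `C_p/e`
and `𝔭^{C_p} × 𝔮` in level `C_p/C_p`. -/
def IsGhostPair {p : ℕ} [Fact p.Prime] {R : CpTambara.{u} p} (I : TIdeal R.ghost)
    (𝔭 : Ideal R.lvlE) (𝔮 : Ideal R.geomFixed) : Prop :=
  I.idealE = 𝔭 ∧ I.idealG = Ideal.prod (𝔭.comap R.fixedE.subtype) 𝔮

/-- `C_p`-prime ideals of a commutative ring with `C_p`-action. -/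
def IsCpPrime (p : ℕ) {B : Type u} [CommRing B] [MulSemiringAction (Cp p) B]
    (𝔭 : Ideal B) : Prop :=
  𝔭 ≠ ⊤ ∧ (∀ (g : Cp p), ∀ x ∈ 𝔭, g • x ∈ 𝔭) ∧
    ∀ x y : B, (∀ g : Cp p, x * g • y ∈ 𝔭) → x ∈ 𝔭 ∨ y ∈ 𝔭

end CpTambara

/-!
Over any `C_p`-Tambara functor, a prime `P` lies in the `e`-th stratum if and only if its level
`C_p/C_p` is the full preimage under `Res` of its level `C_p/e`: the pair `(A; Res⁻¹ A)` is prime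
if and only if `A` is `C_p`-prime, and a `C_p`-prime ideal is the intersection of the conjugates of
any prime ideal minimal over it.

The stratum is closed because `Nm (Res x)` and `x ^ p` agree modulo `ker Res`, so that it equals
`V(0; ker Res)`. It is not open as soon as a prime `Q ⊇ Tr` of level `C_p/C_p` contains
`Nm (Res x)` for some `x ∉ Q`: since the norm is additive modulo transfers, `Q` contains a largest
Tambara ideal, which is prime and lies outside the stratum, but strictly below a point of it.
-/

namespace CpTambara

section GroupAction

variable {G B : Type*} [Group G] [CommRing B] [MulSemiringAction G B]

/-- The largest `G`-stable ideal contained in `𝔯`, that is, the intersection of the conjugates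
of `𝔯`. -/
def stableCore (G : Type*) [Group G] [MulSemiringAction G B] (𝔯 : Ideal B) : Ideal B :=
  ⨅ g : G, 𝔯.comap (MulSemiringAction.toRingHom G B g)

theorem mem_stableCore {𝔯 : Ideal B} {x : B} : x ∈ stableCore G 𝔯 ↔ ∀ g : G, g • x ∈ 𝔯 := by
  simp only [stableCore, Ideal.mem_iInf, Ideal.mem_comap, MulSemiringAction.toRingHom_apply]

/-- The smallest `G`-stable ideal containing `x`, which is generated by the orbit of `x`. -/
def orbitSpan (G : Type*) [Group G] [MulSemiringAction G B] (x : B) : Ideal B :=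
  Ideal.span (MulAction.orbit G x)

theorem mem_orbitSpan_self (x : B) : x ∈ orbitSpan G x :=
  Ideal.subset_span (MulAction.mem_orbit_self x)

theorem smul_mem_orbitSpan {x : B} (g : G) : ∀ y ∈ orbitSpan G x, g • y ∈ orbitSpan G x := by
  suffices h : orbitSpan G x ≤ (orbitSpan G x).comap (MulSemiringAction.toRingHom G B g) from h
  refine Ideal.span_le.2 ?_
  rintro _ ⟨k, rfl⟩
  exact Ideal.subset_span ⟨g * k, mul_smul g k x⟩

theorem orbitSpan_mul_orbitSpan_le {A : Ideal B} (hA : ∀ g : G, ∀ x ∈ A, g • x ∈ A) {x y : B}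
    (hxy : ∀ g : G, x * g • y ∈ A) : orbitSpan G x * orbitSpan G y ≤ A := by
  rw [orbitSpan, orbitSpan, Ideal.span_mul_span', Ideal.span_le]
  rintro _ ⟨_, ⟨g, rfl⟩, _, ⟨k, rfl⟩, rfl⟩
  have h := hA g _ (hxy (g⁻¹ * k))
  rwa [smul_mul', smul_smul, mul_inv_cancel_left] at h

end GroupAction

theorem exists_notMem_mul_mem_of_mem_minimalPrimes {B : Type*} [CommRing B] {I 𝔯 : Ideal B}
    (hI : I.IsRadical) (h𝔯 : 𝔯 ∈ I.minimalPrimes) {x : B} (hx : x ∈ 𝔯) : ∃ s ∉ 𝔯, s * x ∈ I := by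
  have : 𝔯.IsPrime := h𝔯.1.1
  have hx' : algebraMap B (Localization.AtPrime 𝔯) x ∈
      (I.map (algebraMap B (Localization.AtPrime 𝔯))).radical := by
    rw [IsLocalization.AtPrime.radical_map_of_mem_minimalPrimes _ 𝔯 I h𝔯]
    exact Ideal.mem_map_of_mem _ hx
  obtain ⟨n, hn⟩ := hx'
  rw [← map_pow, IsLocalization.algebraMap_mem_map_algebraMap_iff 𝔯.primeCompl] at hn
  obtain ⟨s, hs, hsx⟩ := hn
  refine ⟨s, hs, hI ⟨n + 1, ?_⟩⟩
  have : (s * x) ^ (n + 1) = s ^ n * x * (s * x ^ n) := by ring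
  exact this ▸ I.mul_mem_left _ hsx

namespace IsCpPrime

variable {p : ℕ} {B : Type u} [CommRing B] [MulSemiringAction (Cp p) B] {𝔭 : Ideal B}

theorem of_isPrime (h𝔭 : 𝔭.IsPrime) (hinv : ∀ g : Cp p, ∀ x ∈ 𝔭, g • x ∈ 𝔭) : IsCpPrime p 𝔭 :=
  ⟨h𝔭.ne_top, hinv, fun x y hxy => h𝔭.mem_or_mem (by simpa only [one_smul] using hxy 1)⟩

theorem le_or_le_of_mul_le (h : IsCpPrime p 𝔭) {I J : Ideal B}
    (hJ : ∀ g : Cp p, ∀ x ∈ J, g • x ∈ J) (hIJ : I * J ≤ 𝔭) : I ≤ 𝔭 ∨ J ≤ 𝔭 := by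
  by_contra! hcon
  obtain ⟨x, hxI, hx⟩ := SetLike.not_le_iff_exists.1 hcon.1
  obtain ⟨y, hyJ, hy⟩ := SetLike.not_le_iff_exists.1 hcon.2
  exact (h.2.2 x y fun g => hIJ (Ideal.mul_mem_mul hxI (hJ g y hyJ))).elim hx hy

/-- If `x ^ 2 ∈ 𝔭`, then a maximal product of distinct conjugates of `x` outside `𝔭` is multiplied
into `𝔭` by every conjugate of `x`. -/
theorem isRadical [NeZero p] (h : IsCpPrime p 𝔭) : 𝔭.IsRadical := by
  refine (Ideal.isRadical_iff_pow_one_lt 2 one_lt_two).2 fun x hx => ?_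
  have hone : ∏ g ∈ (∅ : Finset (Cp p)), g • x ∉ 𝔭 := by
    simpa only [Finset.prod_empty] using 𝔭.ne_top_iff_one.1 h.1
  obtain ⟨S, -, hS⟩ :=
    Finite.exists_le_maximal (p := fun S : Finset (Cp p) => ∏ g ∈ S, g • x ∉ 𝔭) hone
  refine (h.2.2 (∏ g ∈ S, g • x) x fun k => ?_).resolve_left hS.prop
  by_cases hk : k ∈ S
  · have hsq : k • x * k • x ∈ 𝔭 := by
      rw [← smul_mul', ← sq]
      exact h.2.1 k _ hx
    rw [← Finset.prod_erase_mul _ _ hk, mul_assoc]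
    exact 𝔭.mul_mem_left _ hsq
  · rw [mul_comm, ← Finset.prod_insert (f := fun g => g • x) hk]
    by_contra hcon
    exact hk (hS.le_of_ge hcon (Finset.subset_insert k S) (Finset.mem_insert_self k S))

theorem stableCore_eq_of_mem_minimalPrimes [NeZero p] (h : IsCpPrime p 𝔭) {𝔯 : Ideal B}
    (h𝔯 : 𝔯 ∈ 𝔭.minimalPrimes) : stableCore (Cp p) 𝔯 = 𝔭 := by
  have : 𝔯.IsPrime := h𝔯.1.1
  refine le_antisymm (fun x hx => ?_) fun x hx => mem_stableCore.2 fun g => h𝔯.1.2 (h.2.1 g x hx)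
  choose s hs hsx using fun g : Cp p =>
    exists_notMem_mul_mem_of_mem_minimalPrimes h.isRadical h𝔯 (mem_stableCore.1 hx g)
  have hprod : ∏ g, s g ∉ 𝔯 := fun hmem =>
    let ⟨g, _, hg⟩ := Ideal.IsPrime.prod_mem_iff.1 hmem
    hs g hg
  refine (h.2.2 (∏ g, s g) x fun g => ?_).resolve_left fun hmem => hprod (h𝔯.1.2 hmem)
  rw [← Finset.prod_erase_mul _ _ (Finset.mem_univ g), mul_assoc]
  exact 𝔭.mul_mem_left _ (hsx g)

theorem exists_stableCore_eq [NeZero p] (h : IsCpPrime p 𝔭) :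
    ∃ 𝔯 : Ideal B, 𝔯.IsPrime ∧ stableCore (Cp p) 𝔯 = 𝔭 := by
  obtain ⟨𝔯, h𝔯⟩ := Ideal.nonempty_minimalPrimes h.1
  exact ⟨𝔯, h𝔯.1.1, h.stableCore_eq_of_mem_minimalPrimes h𝔯⟩

end IsCpPrime

variable {p : ℕ} [Fact p.Prime] {T : CpTambara.{u} p}

attribute [ext] Spec

theorem res_nm_res (x : T.lvlG) : T.res (T.nm (T.res x)) = T.res (x ^ p) := by
  rw [T.res_nm, Finset.prod_congr rfl fun g _ => T.smul_res g x, Finset.prod_const, map_pow]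
  simp

namespace TIdeal

/-- The largest Tambara ideal whose underlying level is a given stable ideal `A`. -/
def resComap (A : Ideal T.lvlE) (hA : ∀ g : Cp p, ∀ x ∈ A, g • x ∈ A) : TIdeal T where
  idealG := A.comap T.res
  idealE := A
  tr_mem x hx := by
    rw [Ideal.mem_comap, T.res_tr]
    exact A.sum_mem fun g _ => hA g x hx
  nm_mem x hx := by
    rw [Ideal.mem_comap, T.res_nm]
    exact A.prod_mem (Finset.mem_univ 1) (hA 1 x hx)
  res_mem _ hx := hx
  smul_mem := hA

theorem le_resComap_iff {I : TIdeal T} {A : Ideal T.lvlE} {hA : ∀ g : Cp p, ∀ x ∈ A, g • x ∈ A} :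
    I ≤ resComap A hA ↔ I.idealE ≤ A :=
  ⟨fun h => h.2, fun h => ⟨fun x hx => h (I.res_mem x hx), h⟩⟩

theorem resComap_mul_resComap_le_iff {A B C : Ideal T.lvlE} {hA : ∀ g : Cp p, ∀ x ∈ A, g • x ∈ A}
    {hB : ∀ g : Cp p, ∀ x ∈ B, g • x ∈ B} {hC : ∀ g : Cp p, ∀ x ∈ C, g • x ∈ C} :
    resComap A hA * resComap B hB ≤ resComap C hC ↔ A * B ≤ C := by
  refine mul_le_iff.trans ⟨fun h => h.2, fun h => ⟨Ideal.mul_le.2 fun x hx y hy => ?_, h⟩⟩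
  change T.res (x * y) ∈ C
  exact map_mul T.res x y ▸ h (Ideal.mul_mem_mul hx hy)

theorem resComap_eq_top_iff {A : Ideal T.lvlE} {hA : ∀ g : Cp p, ∀ x ∈ A, g • x ∈ A} :
    resComap A hA = ⊤ ↔ A = ⊤ :=
  ⟨congrArg idealE, by rintro rfl; rfl⟩

theorem isPrime_resComap_iff {A : Ideal T.lvlE} {hA : ∀ g : Cp p, ∀ x ∈ A, g • x ∈ A} :
    (resComap A hA).IsPrime ↔ IsCpPrime p A := by
  constructor
  · intro hP
    refine ⟨fun h => hP.1 (resComap_eq_top_iff.2 h), hA, fun x y hxy => ?_⟩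
    have hmul : resComap (orbitSpan (Cp p) x) smul_mem_orbitSpan *
        resComap (orbitSpan (Cp p) y) smul_mem_orbitSpan ≤ resComap A hA :=
      resComap_mul_resComap_le_iff.2 (orbitSpan_mul_orbitSpan_le hA hxy)
    exact (hP.2 _ _ hmul).imp (fun h => h.2 (mem_orbitSpan_self x))
      fun h => h.2 (mem_orbitSpan_self y)
  · intro h
    refine ⟨fun htop => h.1 (resComap_eq_top_iff.1 htop), fun I J hIJ => ?_⟩
    exact (h.le_or_le_of_mul_le J.smul_mem (mul_le_iff.1 hIJ).2).imp le_resComap_iff.2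
      le_resComap_iff.2

/-- The Tambara ideal obtained from `P` by adjoining an element of level `C_p/C_p` whose
restriction already lies in `P`. -/
def adjoin (P : TIdeal T) (x : T.lvlG) (hx : T.res x ∈ P.idealE) : TIdeal T where
  idealG := P.idealG ⊔ Ideal.span {x}
  idealE := P.idealE
  tr_mem z hz := Ideal.mem_sup_left (P.tr_mem z hz)
  nm_mem z hz := Ideal.mem_sup_left (P.nm_mem z hz)
  res_mem :=
    have hle : P.idealG ⊔ Ideal.span {x} ≤ P.idealE.comap T.res :=
      sup_le P.res_mem ((Ideal.span_singleton_le_iff_mem _).2 hx)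
    hle
  smul_mem := P.smul_mem

theorem mem_adjoin_self (P : TIdeal T) {x : T.lvlG} (hx : T.res x ∈ P.idealE) :
    x ∈ (P.adjoin x hx).idealG :=
  Ideal.mem_sup_right (Ideal.mem_span_singleton_self x)

theorem adjoin_mul_adjoin_le {P : TIdeal T} {x y : T.lvlG} (hx : T.res x ∈ P.idealE)
    (hy : T.res y ∈ P.idealE) (hxy : x * y ∈ P.idealG) : P.adjoin x hx * P.adjoin y hy ≤ P := by
  refine mul_le_iff.2 ⟨?_, Ideal.mul_le_left⟩
  change (P.idealG ⊔ Ideal.span {x}) * (P.idealG ⊔ Ideal.span {y}) ≤ P.idealG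
  rw [Ideal.sup_mul, Ideal.mul_sup (Ideal.span {x}), Ideal.span_singleton_mul_span_singleton]
  exact sup_le Ideal.mul_le_left
    (sup_le Ideal.mul_le_right ((Ideal.span_singleton_le_iff_mem _).2 hxy))

theorem IsPrime.mem_or_mem_of_res_mem {P : TIdeal T} (hP : P.IsPrime) {x y : T.lvlG}
    (hx : T.res x ∈ P.idealE) (hy : T.res y ∈ P.idealE) (hxy : x * y ∈ P.idealG) :
    x ∈ P.idealG ∨ y ∈ P.idealG :=
  (hP.2 _ _ (adjoin_mul_adjoin_le hx hy hxy)).imp (fun h => h.1 (P.mem_adjoin_self hx))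
    fun h => h.1 (P.mem_adjoin_self hy)

theorem IsPrime.mem_of_pow_mem_of_res_mem {P : TIdeal T} (hP : P.IsPrime) {x : T.lvlG}
    (hx : T.res x ∈ P.idealE) {n : ℕ} (hn : x ^ n ∈ P.idealG) : x ∈ P.idealG := by
  induction n with
  | zero => simpa using P.idealG.mul_mem_left x hn
  | succ n ih =>
    rcases n.eq_zero_or_pos with rfl | hpos
    · simpa using hn
    · have hxn : T.res (x ^ n) ∈ P.idealE := by
        rw [map_pow]
        exact P.idealE.pow_mem_of_mem hx n hpos
      exact (hP.mem_or_mem_of_res_mem hxn hx (pow_succ x n ▸ hn)).elim ih id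

theorem IsPrime.idealG_eq_comap_res_of_ker_res_le {P : TIdeal T} (hP : P.IsPrime)
    (h : RingHom.ker T.res ≤ P.idealG) : P.idealG = P.idealE.comap T.res := by
  refine le_antisymm P.res_mem fun x hx => hP.mem_of_pow_mem_of_res_mem hx (n := p) ?_
  have hker : x ^ p - T.nm (T.res x) ∈ RingHom.ker T.res := by
    rw [RingHom.mem_ker, map_sub, res_nm_res, sub_self]
  exact (Submodule.sub_mem_iff_left _ (P.nm_mem _ hx)).1 (h hker)

end TIdeal

theorem specRes_ideal_eq_resComap (𝔯 : PrimeSpectrum T.lvlE) :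
    (T.specRes 𝔯).ideal =
      TIdeal.resComap (stableCore (Cp p) 𝔯.asIdeal) fun g x hx =>
        mem_stableCore.2 fun k => mul_smul k g x ▸ mem_stableCore.1 hx (k * g) := by
  refine TIdeal.ext (Ideal.ext fun x => ?_) (Ideal.ext fun x => mem_stableCore.symm)
  change T.res x ∈ 𝔯.asIdeal ↔ T.res x ∈ stableCore (Cp p) 𝔯.asIdeal
  simp only [mem_stableCore, T.smul_res, forall_const]

theorem mem_eStratum_iff {P : T.Spec} :
    P ∈ T.eStratum ↔ P.ideal.idealG = P.ideal.idealE.comap T.res := by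
  constructor
  · rintro ⟨𝔯, rfl⟩
    rw [specRes_ideal_eq_resComap]
    rfl
  · intro hG
    have hP : P.ideal = TIdeal.resComap P.ideal.idealE P.ideal.smul_mem := TIdeal.ext hG rfl
    obtain ⟨𝔯, h𝔯, hcore⟩ :=
      (TIdeal.isPrime_resComap_iff.1 (hP ▸ P.isPrime)).exists_stableCore_eq
    refine ⟨⟨𝔯, h𝔯⟩, Spec.ext ?_⟩
    rw [specRes_ideal_eq_resComap, hP]
    simp only [hcore]

theorem isCpPrime_idealE_of_mem_eStratum {P : T.Spec} (hP : P ∈ T.eStratum) :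
    IsCpPrime p P.ideal.idealE := by
  have hG : P.ideal = TIdeal.resComap P.ideal.idealE P.ideal.smul_mem :=
    TIdeal.ext (mem_eStratum_iff.1 hP) rfl
  exact TIdeal.isPrime_resComap_iff.1 (hG ▸ P.isPrime)

theorem IsCpPrime.exists_mem_eStratum {𝔭 : Ideal T.lvlE} (h : IsCpPrime p 𝔭) :
    ∃ P ∈ T.eStratum, P.ideal.idealE = 𝔭 :=
  ⟨⟨TIdeal.resComap 𝔭 h.2.1, TIdeal.isPrime_resComap_iff.2 h⟩, mem_eStratum_iff.2 rfl, rfl⟩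

theorem eStratum_eq_zeroLocus :
    T.eStratum = zeroLocus (TIdeal.resComap (⊥ : Ideal T.lvlE) fun g x hx => by
      rw [Ideal.mem_bot] at hx ⊢
      rw [hx, smul_zero]) := by
  ext P
  constructor
  · intro hP
    exact ⟨mem_eStratum_iff.1 hP ▸ Ideal.comap_mono bot_le, bot_le⟩
  · exact fun h => mem_eStratum_iff.2 (P.isPrime.idealG_eq_comap_res_of_ker_res_le h.1)

theorem isClosed_eStratum : IsClosed T.eStratum := by
  rw [eStratum_eq_zeroLocus]
  exact ⟨TopologicalSpace.isOpen_generateFrom_of_mem ⟨_, rfl⟩⟩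

theorem Spec.specializes_of_le {P Q : T.Spec} (h : P.ideal ≤ Q.ideal) : P ⤳ Q := by
  rw [Specializes, TopologicalSpace.nhds_generateFrom, TopologicalSpace.nhds_generateFrom]
  refine biInf_mono ?_
  rintro _ ⟨hQ, I, rfl⟩
  exact ⟨fun hP => hQ (le_trans hP h), I, rfl⟩

/-- The norm followed by reduction modulo an ideal containing all transfers, which is additive
by Tambara reciprocity. -/
def nmModulo (Q : Ideal T.lvlG) (hQ : T.trIdeal ≤ Q) : T.lvlE →+* T.lvlG ⧸ Q where
  toFun x := Ideal.Quotient.mk Q (T.nm x)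
  map_one' := by rw [map_one, map_one]
  map_mul' x y := by rw [map_mul, map_mul]
  map_zero' := by rw [T.nm_zero, map_zero]
  map_add' x y := by
    rw [T.nm_add, ← RingHom.map_add, Ideal.Quotient.eq, add_sub_cancel_left]
    exact Q.sum_mem fun S _ => hQ ⟨_, rfl⟩

theorem mem_ker_nmModulo {Q : Ideal T.lvlG} {hQ : T.trIdeal ≤ Q} {x : T.lvlE} :
    x ∈ RingHom.ker (nmModulo Q hQ) ↔ T.nm x ∈ Q :=
  Ideal.Quotient.eq_zero_iff_mem

theorem smul_mem_ker_nmModulo {Q : Ideal T.lvlG} {hQ : T.trIdeal ≤ Q} (g : Cp p) :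
    ∀ x ∈ RingHom.ker (nmModulo Q hQ), g • x ∈ RingHom.ker (nmModulo Q hQ) := by
  intro x hx
  rwa [mem_ker_nmModulo, T.nm_smul, ← mem_ker_nmModulo (hQ := hQ)]

/-- The largest Tambara ideal contained in an ideal `Q ⊇ Tr` in level `C_p/C_p`. -/
def nmComap (Q : Ideal T.lvlG) (hQ : T.trIdeal ≤ Q) : TIdeal T where
  idealG := Q ⊓ (RingHom.ker (nmModulo Q hQ)).comap T.res
  idealE := RingHom.ker (nmModulo Q hQ)
  tr_mem x hx :=
    ⟨hQ ⟨x, rfl⟩, (TIdeal.resComap _ smul_mem_ker_nmModulo).tr_mem x hx⟩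
  nm_mem x hx :=
    ⟨mem_ker_nmModulo.1 hx, (TIdeal.resComap _ smul_mem_ker_nmModulo).nm_mem x hx⟩
  res_mem _ hx := hx.2
  smul_mem := smul_mem_ker_nmModulo

theorem le_nmComap_iff {I : TIdeal T} {Q : Ideal T.lvlG} {hQ : T.trIdeal ≤ Q} :
    I ≤ nmComap Q hQ ↔ I.idealG ≤ Q := by
  refine ⟨fun h => h.1.trans inf_le_left, fun h => ?_⟩
  have hE : I.idealE ≤ RingHom.ker (nmModulo Q hQ) := fun x hx =>
    mem_ker_nmModulo.2 (h (I.nm_mem x hx))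
  exact ⟨le_inf h fun x hx => hE (I.res_mem x hx), hE⟩

theorem isPrime_nmComap {Q : Ideal T.lvlG} (hQ : T.trIdeal ≤ Q) [hprime : Q.IsPrime] :
    (nmComap Q hQ).IsPrime := by
  refine ⟨fun h => hprime.ne_top (top_le_iff.1 (le_nmComap_iff.1 h.ge)), fun I J hIJ => ?_⟩
  rw [le_nmComap_iff, le_nmComap_iff, ← hprime.mul_le]
  exact (TIdeal.mul_le_iff.1 hIJ).1.trans inf_le_left

theorem not_isOpen_eStratum {Q : Ideal T.lvlG} (hQ : T.trIdeal ≤ Q) [Q.IsPrime] {x : T.lvlG}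
    (hnm : T.nm (T.res x) ∈ Q) (hx : x ∉ Q) : ¬ IsOpen T.eStratum := by
  intro hopen
  let P : T.Spec := ⟨nmComap Q hQ, isPrime_nmComap hQ⟩
  have hcp : IsCpPrime p P.ideal.idealE :=
    .of_isPrime (RingHom.ker_isPrime (nmModulo Q hQ)) smul_mem_ker_nmModulo
  obtain ⟨P', hP', hE⟩ := hcp.exists_mem_eStratum
  have hspec : P ⤳ P' := Spec.specializes_of_le
    ⟨mem_eStratum_iff.1 hP' ▸ fun y hy => hE ▸ hy.2, hE.ge⟩
  have hP : x ∈ P.ideal.idealG :=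
    mem_eStratum_iff.1 (hspec.mem_open hopen hP') ▸ mem_ker_nmModulo.2 hnm
  exact hx hP.1

variable {R : CpTambara.{u} p}

theorem comap_res_ghost (𝔭 : Ideal R.lvlE) :
    𝔭.comap R.ghost.res = Ideal.prod (𝔭.comap R.fixedE.subtype) ⊤ :=
  Ideal.ext fun _ => (and_iff_left trivial).symm

theorem IsGhostPair.mem_eStratum_iff {P : R.ghost.Spec} {𝔭 : Ideal R.lvlE}
    {𝔮 : Ideal R.geomFixed} (h : IsGhostPair P.ideal 𝔭 𝔮) : P ∈ R.ghost.eStratum ↔ 𝔮 = ⊤ := by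
  rw [CpTambara.mem_eStratum_iff, h.1]
  calc P.ideal.idealG = 𝔭.comap R.ghost.res
    _ ↔ Ideal.prod (𝔭.comap R.fixedE.subtype) 𝔮 = Ideal.prod (𝔭.comap R.fixedE.subtype) ⊤ :=
      Eq.congr h.2 (comap_res_ghost 𝔭)
    _ ↔ 𝔮 = ⊤ := Ideal.prod_inj.trans (and_iff_right rfl)

theorem isGhostPair_top_of_mem_eStratum {P : R.ghost.Spec} (hP : P ∈ R.ghost.eStratum) :
    IsGhostPair P.ideal P.ideal.idealE ⊤ :=
  ⟨rfl, (mem_eStratum_iff.1 hP).trans (comap_res_ghost _)⟩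

theorem mem_eStratum_ghost_iff {P : R.ghost.Spec} :
    P ∈ R.ghost.eStratum ↔ ∃ 𝔭 : Ideal R.lvlE, IsCpPrime p 𝔭 ∧ IsGhostPair P.ideal 𝔭 ⊤ :=
  ⟨fun hP => ⟨P.ideal.idealE, isCpPrime_idealE_of_mem_eStratum hP,
      isGhostPair_top_of_mem_eStratum hP⟩,
    fun ⟨_, _, h⟩ => h.mem_eStratum_iff.2 rfl⟩

theorem IsCpPrime.exists_isGhostPair_top {𝔭 : Ideal R.lvlE} (h : IsCpPrime p 𝔭) :
    ∃ P : R.ghost.Spec, IsGhostPair P.ideal 𝔭 ⊤ := by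
  obtain ⟨P, hP, rfl⟩ := IsCpPrime.exists_mem_eStratum (T := R.ghost) h
  exact ⟨P, isGhostPair_top_of_mem_eStratum hP⟩

/-- The element `(0, 1)` restricts to `0`, but lies outside `R(C_p/e)^{C_p} × 𝔮`. -/
theorem not_isOpen_eStratum_ghost (h : ¬ Function.Surjective R.tr) :
    ¬ IsOpen R.ghost.eStratum := by
  have hΦ : Nontrivial R.geomFixed := Ideal.Quotient.nontrivial_iff.2 fun htop =>
    h fun y => show y ∈ R.trIdeal from htop ▸ Submodule.mem_top
  obtain ⟨𝔮, h𝔮⟩ := Ideal.exists_maximal R.geomFixed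
  let Q : Ideal R.ghost.lvlG := Ideal.prod (⊤ : Ideal R.fixedE) 𝔮
  have : Q.IsPrime := Ideal.isPrime_ideal_prod_top'
  have hQ : R.ghost.trIdeal ≤ Q := by
    rintro _ ⟨x, rfl⟩
    exact ⟨trivial, 𝔮.zero_mem⟩
  refine not_isOpen_eStratum hQ (x := (0, 1)) ?_ fun hx => 𝔮.ne_top_iff_one.1 h𝔮.ne_top hx.2
  change R.ghost.nm 0 ∈ Q
  rw [R.ghost.nm_zero]
  exact Q.zero_mem

end CpTambara

theorem mainTheorem5_general {p : ℕ} [Fact p.Prime] (R : CpTambara.{u} p) :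
    ((∀ (P : R.ghost.Spec) (𝔭 : Ideal R.lvlE) (𝔮 : Ideal R.geomFixed),
        CpTambara.IsGhostPair P.ideal 𝔭 𝔮 → (P ∈ R.ghost.eStratum ↔ 𝔮 = ⊤)) ∧
      (∀ P : R.ghost.Spec, P ∈ R.ghost.eStratum ↔
        ∃ 𝔭 : Ideal R.lvlE, CpTambara.IsCpPrime p 𝔭 ∧ CpTambara.IsGhostPair P.ideal 𝔭 ⊤) ∧
      (∀ 𝔭 : Ideal R.lvlE, CpTambara.IsCpPrime p 𝔭 →
        ∃ P : R.ghost.Spec, CpTambara.IsGhostPair P.ideal 𝔭 ⊤)) ∧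
    (¬ Function.Surjective R.tr → ¬ IsOpen R.ghost.eStratum) ∧
    IsClosed R.ghost.eStratum :=
  ⟨⟨fun _ _ _ h => h.mem_eStratum_iff, fun _ => CpTambara.mem_eStratum_ghost_iff,
      fun _ h => h.exists_isGhostPair_top⟩,
    CpTambara.not_isOpen_eStratum_ghost, CpTambara.isClosed_eStratum⟩

theorem mainTheorem5 {p : ℕ} [Fact p.Prime] (R : CpTambara.{u} p) (hR : R.IsNonzero) :
    ((∀ (P : R.ghost.Spec) (𝔭 : Ideal R.lvlE) (𝔮 : Ideal R.geomFixed),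
        CpTambara.IsGhostPair P.ideal 𝔭 𝔮 → (P ∈ R.ghost.eStratum ↔ 𝔮 = ⊤)) ∧
      (∀ P : R.ghost.Spec, P ∈ R.ghost.eStratum ↔
        ∃ 𝔭 : Ideal R.lvlE, CpTambara.IsCpPrime p 𝔭 ∧ CpTambara.IsGhostPair P.ideal 𝔭 ⊤) ∧
      (∀ 𝔭 : Ideal R.lvlE, CpTambara.IsCpPrime p 𝔭 →
        ∃ P : R.ghost.Spec, CpTambara.IsGhostPair P.ideal 𝔭 ⊤)) ∧
    (¬ Function.Surjective R.tr → ¬ IsOpen R.ghost.eStratum) ∧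
    ((minimalPrimes R.fixedE).Finite → IsClosed R.ghost.eStratum) :=
  let ⟨hpoints, hnotOpen, hclosed⟩ := mainTheorem5_general R
  ⟨hpoints, hnotOpen, fun _ => hclosed⟩
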